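/- Let $p(m)$ denote the number of partitions of $m$ for integers $m\ge 0$ (so $p(0)=1$), let $p(m)=0$ for $m<0$, and let $\omega(k)=(3k^2+k)/2$. Write $(x)_m=x(x-1)\cdots(x-m+1)$, and for integers $\nu\ge 1$, $n$, $k$ put $$g_\nu(n,k)=\frac{(2\nu-1)\,\big((2\nu-2)_{\nu-1}\big)^2}{2^{2\nu-2}}\sum_{r=0}^{\nu}(-1)^{\nu+r}\frac{2\nu-2r-1}{(2r)!\,(2\nu-2r)!}\,(6k+1)^{2r}\,\big(24n-(6k+1)^2\big)^{\nu-r}.$$ Let $B_m$ be the Bernoulli numbers, $\sigma_m(n)=\sum_{d\mid n}d^m$, let $E_4,E_6$ be the Eisenstein series of weights $4,6$ on $\mathrm{SL}_2(\mathbb Z)$ with constant term $1$, let $\Delta=\eta^{24}$, where $\eta$ is the Dedekind eta function, and set $$\Delta_{12}=\Delta,\quad \Delta_{16}=\Delta E_4,\quad \Delta_{18}=\Delta E_6,\quad \Delta_{20}=\Delta E_4^2,\quad \Delta_{22}=\Delta E_4E_6,\quad \Delta_{26}=\Delta E_4^2E_6 .$$ For $\nu\in\{6,8,9,10,11,13\}$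 let $\tau_{2\nu}(n)$ be the coefficient of $q^n$ ($q=e^{2\pi i z}$) in the Fourier expansion of $\Delta_{2\nu}$, and let $$\beta_6=-\tfrac{33108590592}{691},\quad \beta_8=-\tfrac{187167592415232}{3617},\quad \beta_9=-\tfrac{28682634201661440}{43867},$$ $$\beta_{10}=-\tfrac{8294726176465158144}{174611},\quad \beta_{11}=-\tfrac{101475065073734516736}{77683},\quad \beta_{13}=-\tfrac{1195065734266339700244480}{657931}.$$ 1. Let $\nu\in\{6,8,9,10,11,13\}$. Then $\Delta_{2\nu}$ is a cusp form of weight $2\nu$ on $\mathrm{SL}_2(\mathbb Z)$ with $\tau_{2\nu}(1)=1$, and every cusp form of weight $2\nu$ on $\mathrm{SL}_2(\mathbb Z)$ is a scalar multiple of it. For every integer $n\ge 1$ we have $g_\nu(n,0)\ne 0$ and $$p(n)=\frac{1}{g_\nu(n,0)}\left(-\frac{4\nu}{B_{2\nu}}\binom{2\nu-2}{\nu-2}\sigma_{2\nu-1}(n)+\beta_\nu\,\tau_{2\nu}(n)+\sum_{k\in\mathbb Z\setminus\{0\}}(-1)^{k+1}g_\nu(n,k)\,p(n-\omega(k))\right).$$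 2. For $\tau(n)=\tau_{12}(n)$, Ramanujan's tau function, and every integer $n\ge 1$, $$\tau(n)=\frac{2275}{5474304}\,\sigma_{11}(n)-\frac{691}{33108590592}\,g_6(n,0)\,p(n)+\frac{691}{33108590592}\sum_{k\in\mathbb Z\setminus\{0\}}(-1)^{k+1}g_6(n,k)\,p(n-\omega(k)).$$ 3. For every integer $n\ge 1$, $\tau(n)$ is an integer and $\tau(n)\equiv\sigma_{11}(n)\pmod{691}$. -/

import Mathlib

open scoped MatrixGroups

noncomputable section

namespace PartitionRecurrence

/-- The pentagonal number `ω(m) = (3 m ^ 2 + m) / 2` (the division is exact, see `two_mul_omega`). -/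
def omega (m : ℤ) : ℤ := (3 * m ^ 2 + m) / 2

theorem two_mul_omega (m : ℤ) : 2 * omega m = 3 * m ^ 2 + m := by
  unfold omega
  rcases Int.even_or_odd' m with ⟨c, rfl | rfl⟩ <;> ring_nf <;> omega

/-- The partition function extended to the integers: `p(m)` is the number of partitions of `m` for
`m ≥ 0` (so `p(0) = 1`), and `p(m) = 0` for `m < 0`. -/
def p (m : ℤ) : ℕ := if 0 ≤ m then Fintype.card (Nat.Partition m.toNat) else 0

/-- The falling factorial `(x)_m`, for an arbitrary integer `m`: it is `x (x - 1) ⋯ (x - m + 1)`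
for `m ≥ 0` and `1 / (x)_{-m}` for `m < 0`. -/
def fallingFactorial (x : ℚ) : ℤ → ℚ
  | Int.ofNat m => ∏ i ∈ Finset.range m, (x - i)
  | Int.negSucc m => 1 / ∏ i ∈ Finset.range (m + 1), (x - i)

/-- The polynomial weights `g_ν(n, k)` of the recurrence. -/
def g (ν : ℕ) (n k : ℤ) : ℚ :=
  ((2 * (ν : ℚ) - 1) * fallingFactorial (2 * (ν : ℚ) - 2) ((ν : ℤ) - 1) ^ 2
      / (2 : ℚ) ^ (2 * (ν : ℤ) - 2)) *
    ∑ r ∈ Finset.range (ν + 1),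
      (-1 : ℚ) ^ (ν + r) * (2 * (ν : ℚ) - 2 * (r : ℚ) - 1)
        / (((2 * r).factorial : ℚ) * ((2 * ν - 2 * r).factorial : ℚ))
        * (6 * (k : ℚ) + 1) ^ (2 * r) * (24 * (n : ℚ) - (6 * (k : ℚ) + 1) ^ 2) ^ (ν - r)

/-- The sum `∑_{k ≠ 0} (-1) ^ (k + 1) g_ν(n, k) p(n - ω(k))` over all nonzero integers `k`.
All but finitely many terms vanish, see `pentagonalSum_finite`. -/
def pentagonalSum (ν : ℕ) (n : ℤ) : ℚ :=
  ∑ᶠ (k : ℤ) (_ : k ≠ 0), (-1 : ℚ) ^ (k + 1) * g ν n k * (p (n - omega k) : ℚ)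

theorem abs_le_omega (k : ℤ) : |k| ≤ omega k := by
  have h := two_mul_omega k
  rcases abs_cases k with ⟨hk, h0⟩ | ⟨hk, h0⟩ <;> rw [hk] <;> nlinarith

theorem pentagonalSum_finite (ν : ℕ) (n : ℤ) :
    {k : ℤ | (-1 : ℚ) ^ (k + 1) * g ν n k * (p (n - omega k) : ℚ) ≠ 0}.Finite := by
  refine (Set.finite_Icc (-n) n).subset fun k hk => ?_
  rw [Set.mem_Icc, ← abs_le]
  by_contra hlt
  apply hk
  have := abs_le_omega k
  have hp : p (n - omega k) = 0 := if_neg (by linarith)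
  simp [hp]

/-- The function `Δ_{2ν}` on the upper half-plane, for `ν ∈ {6, 8, 9, 10, 11, 13}` (and `0` for
the other `ν`, which play no role). Here `ModularForm.discriminant` is `η ^ 24`, and
`ModularForm.E₄`, `ModularForm.E₆` are the Eisenstein series of weights 4 and 6
with constant term `1`. -/
def cuspDelta (ν : ℕ) (z : UpperHalfPlane) : ℂ :=
  match ν with
  | 6 => ModularForm.discriminant z
  | 8 => ModularForm.discriminant z * ModularForm.E₄ z
  | 9 => ModularForm.discriminant z * ModularForm.E₆ z
  | 10 => ModularForm.discriminant z * ModularForm.E₄ z ^ 2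
  | 11 => ModularForm.discriminant z * ModularForm.E₄ z * ModularForm.E₆ z
  | 13 => ModularForm.discriminant z * ModularForm.E₄ z ^ 2 * ModularForm.E₆ z
  | _ => 0

/-- `τ_{2ν}(n)`: the coefficient of `q ^ n`, `q = exp(2πiz)`, in the Fourier expansion
of `Δ_{2ν}`. In particular `tau 6` is Ramanujan's tau function. -/
def tau (ν n : ℕ) : ℂ := (UpperHalfPlane.qExpansion 1 (cuspDelta ν)).coeff n

/-- The constants `β_ν` for `ν ∈ {6, 8, 9, 10, 11, 13}` (and `0` for the other `ν`,
which play no role). -/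
def beta (ν : ℕ) : ℚ :=
  match ν with
  | 6 => -33108590592 / 691
  | 8 => -187167592415232 / 3617
  | 9 => -28682634201661440 / 43867
  | 10 => -8294726176465158144 / 174611
  | 11 => -101475065073734516736 / 77683
  | 13 => -1195065734266339700244480 / 657931
  | _ => 0

end PartitionRecurrence

end

/-! The recurrence says that a Rankin-Cohen bracket of `η` (weight 1/2) and `1/η` (weight -1/2) is a
modular form of weight `2ν` on `SL₂(ℤ)`. By Euler, `η = q^(1/24) ∑ (-1)^k q^ω(k)` and `1/η =
q^(-1/24) ∑ p(n) q^n`. The bracket applies powers of `q d/dq` to both factors, so its `n`-th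
coefficient is a sum of `(-1)^k p(n - ω(k))` weighted by a polynomial in `ω(k) + 1/24 = (6k+1)²/24`
and `n - ω(k) - 1/24`. Up to a constant this weight is `g_ν(n, k)`
(`coeff_etaBracket_eq_recurrenceSum`).

Modularity (`etaBracket_mem`) is proved on formal `q`-series, so no half-integral weight forms or
multipliers occur. The only input on `η^(±1)` is its logarithmic derivative `±E₂/24`. With `e =
E₂/12`, the quotients `Dⁿf / (n! (k)_n f)` are universal polynomials in `e` and its derivatives.
Multiplying their generating series by `exp(-eX)` removes the quasimodular part, by Ramanujan's
identity `D e = e² + w` with `w` modular of weight 4 and by the Serre derivative. In the bracket the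
two exponentials cancel.

For the six values of `ν`, the cusp forms of weight `2ν` are the multiples of `Δ_{2ν}`, so a form is
fixed by its coefficients at 0 and 1. These give the binomial coefficient and `β_ν`. Since 691 is
the numerator of `-B₁₂`, clearing denominators for `ν = 6` gives Ramanujan's congruence, once `τ(n)`
is known to be an integer from `1728 Δ = E₄³ - E₆²`. -/

/-! ### Formal Cohen-Kuznetsov lifts over a differential ring -/

section CohenKuznetsov

open PowerSeries Nat

variable {R : Type*} [CommRing R] [Algebra ℚ R]

/-- A derivation of the coefficient ring, applied to each coefficient of a power series. -/
noncomputable def coeffDeriv (D : Derivation ℚ R R) (F : R⟦X⟧) : R⟦X⟧ :=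
  .mk fun n ↦ D (coeff n F)

theorem coeff_coeffDeriv (D : Derivation ℚ R R) (F : R⟦X⟧) (n : ℕ) :
    coeff n (coeffDeriv D F) = D (coeff n F) := coeff_mk _ _

theorem coeffDeriv_mul (D : Derivation ℚ R R) (F G : R⟦X⟧) :
    coeffDeriv D (F * G) = F * coeffDeriv D G + coeffDeriv D F * G := by
  ext n
  simp only [coeff_coeffDeriv, map_add, coeff_mul, map_sum, Derivation.leibniz, smul_eq_mul,
    Finset.sum_add_distrib]
  congr 1
  exact Finset.sum_congr rfl fun _ _ ↦ mul_comm _ _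

theorem coeffDeriv_rescale_exp (D : Derivation ℚ R R) (a : R) :
    coeffDeriv D (rescale a (exp R)) = X * C (D a) * rescale a (exp R) := by
  ext n
  rw [coeff_coeffDeriv, mul_assoc]
  cases n with
  | zero => simp
  | succ n =>
    rw [coeff_succ_X_mul, coeff_C_mul]
    simp only [coeff_rescale, coeff_exp, Derivation.leibniz, Derivation.map_algebraMap,
      Derivation.leibniz_pow, smul_eq_mul, mul_zero, zero_add, Nat.add_sub_cancel]
    have : algebraMap ℚ R (1 / (n ! : ℚ)) = (n + 1 : ℕ) * algebraMap ℚ R (1 / ((n + 1)! : ℚ)) := by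
      rw [← map_natCast (algebraMap ℚ R), ← map_mul]
      congr 1
      rw [Nat.factorial_succ]
      push_cast
      field_simp
    rw [this, nsmul_eq_mul]
    ring

theorem derivative_rescale_exp (a : R) :
    d⁄dX R (rescale a (exp R)) = C a * rescale a (exp R) := by
  ext n
  rw [coeff_derivative, coeff_C_mul]
  simp only [coeff_rescale, coeff_exp]
  have : algebraMap ℚ R (1 / (n ! : ℚ)) = (n + 1 : ℕ) * algebraMap ℚ R (1 / ((n + 1)! : ℚ)) := by
    rw [← map_natCast (algebraMap ℚ R), ← map_mul]
    congr 1
    rw [Nat.factorial_succ]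
    push_cast
    field_simp
  rw [this]
  push_cast
  ring

/-- The coefficients `D ^ n f / (n! (k)_n f)` of the Cohen-Kuznetsov lift of an element `f`
of weight `k` with `D f = k e f`. -/
noncomputable def ckCoeff (D : Derivation ℚ R R) (e : R) (k : ℚ) : ℕ → R
  | 0 => 1
  | n + 1 => ((n + 1) * (k + n))⁻¹ • (D (ckCoeff D e k n) + k • (e * ckCoeff D e k n))

/-- The Cohen-Kuznetsov series with its quasimodular exponential factor removed. -/
noncomputable def ckModular (D : Derivation ℚ R R) (e : R) (k : ℚ) : R⟦X⟧ :=
  rescale (-e) (exp R) * .mk (ckCoeff D e k)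

variable {D : Derivation ℚ R R} {e w : R} {k : ℚ}

theorem ckCoeff_succ_smul (hk : ∀ n : ℕ, k + n ≠ 0) (n : ℕ) :
    ((n + 1) * (k + n)) • ckCoeff D e k (n + 1) =
      D (ckCoeff D e k n) + k • (e * ckCoeff D e k n) := by
  rw [ckCoeff, smul_smul, mul_inv_cancel₀, one_smul]
  exact mul_ne_zero (by positivity) (hk n)

/-- The recursion defining `ckCoeff`, read as a heat-type equation for its generating series. -/
theorem ckSeries_ode (hk : ∀ n : ℕ, k + n ≠ 0) :
    X * d⁄dX R (d⁄dX R (.mk (ckCoeff D e k))) + C (algebraMap ℚ R k) *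
        d⁄dX R (.mk (ckCoeff D e k)) =
      coeffDeriv D (.mk (ckCoeff D e k)) + C (algebraMap ℚ R k * e) * .mk (ckCoeff D e k) := by
  ext n
  have h := ckCoeff_succ_smul (D := D) (e := e) hk n
  simp only [Algebra.smul_def, map_mul, map_add, map_natCast, map_one] at h
  simp only [map_add, coeff_coeffDeriv, coeff_C_mul, coeff_mk, coeff_derivative, ← mul_assoc]
  rw [← mul_assoc] at h
  rw [mul_assoc (algebraMap ℚ R k) e, ← mul_assoc, ← h]
  cases n with
  | zero => simp
  | succ n =>
    rw [coeff_succ_X_mul]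
    simp only [coeff_derivative, coeff_mk]
    push_cast
    ring

/-- Substituting `exp(-eX) H` into the equation for `H` cancels the terms in `k e` and, because `D e
= e² + w`, those in `e²`. What remains involves `e` only through the correction term of a Serre
derivative. -/
theorem ckModular_ode (hk : ∀ n : ℕ, k + n ≠ 0) (he : D e = e ^ 2 + w) :
    X * d⁄dX R (d⁄dX R (ckModular D e k)) + C (algebraMap ℚ R k) * d⁄dX R (ckModular D e k) =
      coeffDeriv D (ckModular D e k) - 2 * C e * (X * d⁄dX R (ckModular D e k))
        + X * (C w * ckModular D e k) := by
  have h := ckSeries_ode (D := D) (e := e) hk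
  set H : R⟦X⟧ := .mk (ckCoeff D e k)
  have hA : ckModular D e k = rescale (-e) (exp R) * H := rfl
  set S := rescale (-e) (exp R)
  have hS : d⁄dX R S = -C e * S := by rw [derivative_rescale_exp, map_neg]
  have hD : coeffDeriv D S = -(X * (C e ^ 2 + C w) * S) := by
    rw [coeffDeriv_rescale_exp, map_neg, he, map_neg, map_add, map_pow]
    ring
  have hC : d⁄dX R (C e : R⟦X⟧) = 0 := derivative_C
  rw [hA, coeffDeriv_mul, hD]
  simp only [Derivation.leibniz, hS, smul_eq_mul, map_add, map_neg, hC]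
  rw [map_mul] at h
  linear_combination S * h

/-- The coefficient of index `n` has weight `2n`, so `D - 2n e` is the Serre derivative on it. The
last term multiplies the preceding coefficient by `w`. -/
theorem coeff_ckModular_succ (hk : ∀ n : ℕ, k + n ≠ 0) (he : D e = e ^ 2 + w) (n : ℕ) :
    coeff (n + 1) (ckModular D e k) = ((n + 1) * (k + n))⁻¹ •
      (D (coeff n (ckModular D e k)) - (2 * n : ℚ) • (e * coeff n (ckModular D e k)) +
        coeff n (X * (C w * ckModular D e k))) := by
  have h := congrArg (coeff n) (ckModular_ode (D := D) hk he)
  rw [eq_inv_smul_iff₀ (mul_ne_zero (by positivity) (hk n))]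
  simp only [map_add, map_sub, coeff_coeffDeriv, coeff_C_mul, coeff_derivative] at h
  rw [show (2 : R⟦X⟧) * C e = C (2 * e) by rw [map_mul, map_ofNat], coeff_C_mul] at h
  rw [Algebra.smul_def, Algebra.smul_def]
  simp only [map_mul, map_add, map_natCast, map_one, map_ofNat]
  cases n with
  | zero => simpa using h
  | succ n =>
    simp only [coeff_succ_X_mul, coeff_derivative] at h ⊢
    push_cast at h ⊢
    linear_combination h

theorem ckModular_coeff_zero : coeff 0 (ckModular D e k) = 1 := by
  rw [ckModular, coeff_mul]
  simp only [Finset.Nat.antidiagonal_zero, Finset.sum_singleton, coeff_rescale, coeff_exp, coeff_mk]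
  simp [ckCoeff]

/-- If a graded family of submodules is closed under products, multiplication by `w` (weight 4)
and the Serre derivative, then the modular Cohen-Kuznetsov coefficients lie in it. -/
theorem coeff_ckModular_mem (M : ℕ → Submodule ℚ R) (hone : 1 ∈ M 0)
    (hmul : ∀ a b f g, f ∈ M a → g ∈ M b → f * g ∈ M (a + b))
    (hserre : ∀ a f, f ∈ M a → D f - (a : ℚ) • (e * f) ∈ M (a + 2))
    (hw : w ∈ M 4) (hk : ∀ n : ℕ, k + n ≠ 0) (he : D e = e ^ 2 + w) (n : ℕ) :
    coeff n (ckModular D e k) ∈ M (2 * n) := by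
  induction n using Nat.strong_induction_on with
  | _ n ih =>
    cases n with
    | zero => rwa [ckModular_coeff_zero]
    | succ n =>
      rw [coeff_ckModular_succ hk he]
      refine Submodule.smul_mem _ _ (Submodule.add_mem _ ?_ ?_)
      · have := hserre _ _ (ih n (by lia))
        push_cast at this
        exact this
      · cases n with
        | zero => simp
        | succ n =>
          rw [coeff_succ_X_mul, coeff_C_mul]
          have := hmul _ _ _ _ hw (ih n (by lia))
          rwa [show 4 + 2 * n = 2 * (n + 1 + 1) by ring] at this

/-- The Rankin-Cohen bracket of two Cohen-Kuznetsov lifts, normalized. -/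
theorem sum_ckCoeff_mul (k l : ℚ) (n : ℕ) :
    ∑ x ∈ Finset.HasAntidiagonal.antidiagonal n, (-1) ^ x.1 * ckCoeff D e k x.1 * ckCoeff D e l x.2 =
      ∑ x ∈ Finset.HasAntidiagonal.antidiagonal n,
        (-1) ^ x.1 * coeff x.1 (ckModular D e k) * coeff x.2 (ckModular D e l) := by
  -- Under `X ↦ -X` the factor `exp(-eX)` of the first series becomes `exp(eX)`, which cancels that
  -- of the second.
  have h : rescale (-1) (ckModular D e k) * ckModular D e l =
      rescale (-1) (.mk (ckCoeff D e k)) * .mk (ckCoeff D e l) := by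
    have h1 : rescale e (exp R) * rescale (-e) (exp R) = 1 := by
      rw [exp_mul_exp_eq_exp_add]
      simp
    rw [ckModular, ckModular, map_mul, rescale_rescale, mul_neg_one, neg_neg]
    linear_combination rescale (-1) (.mk (ckCoeff D e k)) * .mk (ckCoeff D e l) * h1
  have := congrArg (coeff n) h
  simpa only [coeff_mul, coeff_rescale, coeff_mk, eq_comm] using this.symm

/-- The rising factorial `(k)_n`, times `n!`. -/
noncomputable def ckFactor (k : ℚ) (n : ℕ) : ℚ := ∏ i ∈ Finset.range n, ((i + 1) * (k + i))

theorem ckFactor_succ (k : ℚ) (n : ℕ) :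
    ckFactor k (n + 1) = ckFactor k n * ((n + 1) * (k + n)) := Finset.prod_range_succ _ _

theorem ckFactor_ne_zero (hk : ∀ n : ℕ, k + n ≠ 0) (n : ℕ) : ckFactor k n ≠ 0 :=
  Finset.prod_ne_zero_iff.2 fun i _ ↦ mul_ne_zero (by positivity) (hk i)

/-- Iterating the twisted derivation `D + a` on a solution of `D f + a f = k e f`. -/
theorem iterate_twisted_derivation (hk : ∀ n : ℕ, k + n ≠ 0) {f : R} {a : ℚ}
    (hf : D f + a • f = k • (e * f)) (n : ℕ) :
    (fun x ↦ D x + a • x)^[n] f = ckFactor k n • (f * ckCoeff D e k n) := by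
  induction n with
  | zero => simp [ckFactor, ckCoeff]
  | succ n ih =>
    rw [Function.iterate_succ_apply', ih, ckFactor_succ, mul_smul,
      ← mul_smul_comm ((n + 1) * (k + n)), ckCoeff_succ_smul hk]
    simp only [Derivation.map_smul, Derivation.leibniz, smul_eq_mul]
    simp only [Algebra.smul_def] at hf ⊢
    linear_combination algebraMap ℚ R (ckFactor k n) * ckCoeff D e k n * hf

end CohenKuznetsov

/-! ### Logarithmic derivative and inverse of the Euler product -/

section EulerSeries

open PowerSeries Filter

/-- The operator `q d/dq` on power series. -/
noncomputable def theta : Derivation ℚ ℂ⟦X⟧ ℂ⟦X⟧ :=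
  ((X : ℂ⟦X⟧) • PowerSeries.derivative ℂ).restrictScalars ℚ

theorem coeff_theta (f : ℂ⟦X⟧) (n : ℕ) : coeff n (theta f) = n * coeff n f := by
  change coeff n (X * d⁄dX ℂ f) = _
  cases n with
  | zero => simp
  | succ n =>
    rw [coeff_succ_X_mul, coeff_derivative]
    push_cast
    ring

theorem coeff_iterate_theta_add (a : ℚ) (f : ℂ⟦X⟧) (r n : ℕ) :
    coeff n ((fun x ↦ theta x + a • x)^[r] f) = (n + a) ^ r * coeff n f := by
  induction r with
  | zero => simp
  | succ r ih =>
    rw [Function.iterate_succ_apply', map_add, coeff_theta, coeff_smul, ih, Rat.smul_def]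
    ring

theorem theta_X_pow (n : ℕ) : theta ((X : ℂ⟦X⟧) ^ n) = n * (X : ℂ⟦X⟧) ^ n := by
  ext m
  rw [coeff_theta, ← map_natCast (C : ℂ →+* ℂ⟦X⟧), coeff_C_mul, coeff_X_pow]
  split_ifs with h <;> simp [h]

/-- The Lambert series `∑ n X ^ (n j)` over `j ≥ 1`. -/
noncomputable def lambertTerm (n : ℕ) : ℂ⟦X⟧ := .mk fun m ↦ if m ≠ 0 ∧ n ∣ m then n else 0

theorem one_sub_X_pow_mul_lambertTerm {n : ℕ} (hn : n ≠ 0) :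
    (1 - (X : ℂ⟦X⟧) ^ n) * lambertTerm n = n * (X : ℂ⟦X⟧) ^ n := by
  ext m
  rw [sub_mul, one_mul, map_sub, coeff_X_pow_mul', ← map_natCast (C : ℂ →+* ℂ⟦X⟧), coeff_C_mul,
    coeff_X_pow]
  simp only [lambertTerm, coeff_mk]
  rcases lt_trichotomy m n with h | rfl | h
  · have : ¬ (m ≠ 0 ∧ n ∣ m) := fun h' ↦ h.not_ge (Nat.le_of_dvd (by lia) h'.2)
    simp [this, h.ne, h.not_ge]
  · simp [hn]
  · have : n ∣ m - n ↔ n ∣ m := (Nat.dvd_sub_iff_left h.le dvd_rfl)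
    simp [h.ne', h.le, this, show m ≠ 0 by lia, show m - n ≠ 0 by lia]

theorem theta_prod_one_sub_X_pow (N : ℕ) :
    theta (∏ n ∈ Finset.range N, (1 - X ^ (n + 1))) =
      -((∏ n ∈ Finset.range N, (1 - X ^ (n + 1))) *
        ∑ n ∈ Finset.range N, lambertTerm (n + 1)) := by
  induction N with
  | zero => simp
  | succ N ih =>
    rw [Finset.prod_range_succ, Finset.sum_range_succ, Derivation.leibniz, ih, map_sub,
      theta_X_pow, Derivation.map_one_eq_zero, ← one_sub_X_pow_mul_lambertTerm (show N + 1 ≠ 0 by lia)]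
    simp only [smul_eq_mul]
    ring

/-- The generating series of the divisor sum `σ₁`. -/
noncomputable def sigmaSeries : ℂ⟦X⟧ := .mk fun m ↦ (ArithmeticFunction.sigma 1 m : ℂ)

theorem coeff_sum_lambertTerm {m N : ℕ} (h : m ≤ N) :
    coeff m (∑ n ∈ Finset.range N, lambertTerm (n + 1)) = coeff m sigmaSeries := by
  simp only [map_sum, lambertTerm, sigmaSeries, coeff_mk]
  rcases eq_or_ne m 0 with rfl | hm
  · simp
  · simp only [hm, ne_eq, not_false_eq_true, true_and, ArithmeticFunction.sigma_one_apply]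
    have hdiv : m.divisors =
        ((Finset.range N).filter (fun n ↦ n + 1 ∣ m)).map (addRightEmbedding 1) := by
      ext d
      simp only [Nat.mem_divisors, Finset.mem_map, Finset.mem_filter, Finset.mem_range,
        addRightEmbedding_apply]
      constructor
      · rintro ⟨hd, -⟩
        have := Nat.le_of_dvd (by lia) hd
        have := Nat.pos_of_dvd_of_pos hd (by lia)
        exact ⟨d - 1, ⟨by lia, by rwa [Nat.sub_add_cancel this]⟩, by lia⟩
      · rintro ⟨n, ⟨-, hn⟩, rfl⟩
        exact ⟨hn, hm⟩
    rw [← Finset.sum_filter, hdiv, Finset.sum_map]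
    simp

/-- Logarithmic differentiation of Euler's product. A finite product with `N ≥ m` factors that
already has the limiting coefficients up to `m` suffices for the coefficient of index `m`. -/
theorem theta_pentagonalSeries :
    theta (pentagonalSeries ℂ) = -(pentagonalSeries ℂ * sigmaSeries) := by
  ext m
  have h : ∀ᶠ N : ℕ in atTop, ∀ i ∈ Finset.range (m + 1),
      coeff i (∏ n ∈ Finset.range N, (1 - X ^ (n + 1) : ℂ⟦X⟧)) = coeff i (pentagonalSeries ℂ) := by
    rw [Filter.eventually_all_finset]
    exact fun i _ ↦ tendsto_finset_range.eventually (coeff_prod_one_sub_X_pow_eventually_eq ℂ i)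
  obtain ⟨N, hN, hmN⟩ := (h.and (eventually_ge_atTop m)).exists
  have hP := congrArg (coeff m) (theta_prod_one_sub_X_pow N)
  rw [coeff_theta, hN m (by simp), map_neg, coeff_mul] at hP
  rw [coeff_theta, hP, map_neg, coeff_mul, neg_inj]
  refine Finset.sum_congr rfl fun x hx ↦ ?_
  have hx := Finset.HasAntidiagonal.mem_antidiagonal.1 hx
  rw [hN x.1 (by simp; lia), coeff_sum_lambertTerm (by lia)]

/-- The `q`-expansion of `E₂ / 12`. -/
noncomputable def eisensteinTwo : ℂ⟦X⟧ := (1 / 12 : ℚ) • (1 - 24 * sigmaSeries)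

/-- This is `D η = (1/2) e η` for `η = q^(1/24) P`, where `P` is the pentagonal series: on the
series without the fractional power, `D` acts as `D + 1/24`. -/
theorem theta_pentagonalSeries_add : theta (pentagonalSeries ℂ) +
    (1 / 24 : ℚ) • pentagonalSeries ℂ = (1 / 2 : ℚ) • (eisensteinTwo * pentagonalSeries ℂ) := by
  rw [theta_pentagonalSeries, eisensteinTwo, smul_mul_assoc, smul_smul]
  have : (24 : ℂ⟦X⟧) = algebraMap ℚ ℂ⟦X⟧ 24 := (map_ofNat _ 24).symm
  rw [sub_mul, smul_sub, one_mul, this, ← Algebra.smul_def, smul_mul_assoc, smul_smul]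
  norm_num
  ring

/-- The generating series of the partition function. -/
noncomputable def partitionSeries : ℂ⟦X⟧ := .mk fun n ↦ (Fintype.card (Nat.Partition n) : ℂ)

theorem pentagonalSeries_mul_partitionSeries : pentagonalSeries ℂ * partitionSeries = 1 := by
  symm
  -- With discrete coefficients, convergence of power series means that each coefficient stabilizes.
  let _ : TopologicalSpace ℂ := ⊥
  have : DiscreteTopology ℂ := ⟨rfl⟩
  let _ : TopologicalSpace ℂ⟦X⟧ := WithPiTopology.instTopologicalSpace ℂ
  have : ContinuousMul ℂ⟦X⟧ := (WithPiTopology.instIsTopologicalSemiring ℂ).toContinuousMul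
  have : T2Space ℂ⟦X⟧ := WithPiTopology.instT2Space ℂ
  have h := (WithPiTopology.hasProd_one_sub_X_pow ℂ).mul
    (Nat.Partition.hasProd_powerSeriesMk_card_restricted ℂ (fun _ ↦ True))
  have hone : (fun n ↦ (1 - X ^ (n + 1) : ℂ⟦X⟧) *
      if True then ∑' j : ℕ, X ^ ((n + 1) * j) else 1) = fun _ ↦ 1 := by
    ext1 n
    simp_rw [if_true, pow_mul]
    exact WithPiTopology.one_sub_mul_tsum_pow_of_constantCoeff_eq_zero (by simp)
  rw [hone] at h
  refine (hasProd_one.unique h).trans ?_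
  congr 1
  ext n
  simp [partitionSeries, Nat.Partition.restricted, Finset.card_univ]

end EulerSeries

/-! ### Level-one forms as power series, Serre derivative and `E₂` -/

section ModularSeries

open UpperHalfPlane hiding I
open PowerSeries Filter ModularForm Derivative Complex
open scoped Manifold Topology Real

local notation "𝕢" => Function.Periodic.qParam

/-- The function `f` on the upper half-plane is the sum of the power series `φ`
in `q = exp (2 π i z)`. -/
def HasQExpansion (f : ℍ → ℂ) (φ : ℂ⟦X⟧) : Prop :=
  ∀ τ : ℍ, HasSum (fun m : ℕ ↦ coeff m φ * 𝕢 1 τ ^ m) (f τ)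

theorem HasQExpansion.congr {f g : ℍ → ℂ} {φ ψ : ℂ⟦X⟧} (h : HasQExpansion f φ) (hf : f = g)
    (hφ : φ = ψ) : HasQExpansion g ψ := hf ▸ hφ ▸ h

namespace HasQExpansion

variable {f g : ℍ → ℂ} {φ ψ : ℂ⟦X⟧}

theorem add (hf : HasQExpansion f φ) (hg : HasQExpansion g ψ) :
    HasQExpansion (f + g) (φ + ψ) := fun τ ↦ by
  simpa [add_mul] using (hf τ).add (hg τ)

theorem sub (hf : HasQExpansion f φ) (hg : HasQExpansion g ψ) :
    HasQExpansion (f - g) (φ - ψ) := fun τ ↦ by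
  simpa [sub_mul] using (hf τ).sub (hg τ)

theorem smul (c : ℂ) (hf : HasQExpansion f φ) : HasQExpansion (c • f) (c • φ) := fun τ ↦ by
  simpa [mul_assoc] using (hf τ).mul_left c

theorem mul (hf : HasQExpansion f φ) (hg : HasQExpansion g ψ) :
    HasQExpansion (f * g) (φ * ψ) := fun τ ↦ by
  have hF := (hf τ).summable.norm
  have hG := (hg τ).summable.norm
  have h := (summable_norm_sum_mul_antidiagonal_of_summable_norm hF hG).of_norm.hasSum
  rw [← tsum_mul_tsum_eq_tsum_sum_antidiagonal_of_summable_norm hF hG, (hf τ).tsum_eq,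
    (hg τ).tsum_eq] at h
  refine h.congr_fun fun m ↦ ?_
  rw [coeff_mul, Finset.sum_mul]
  refine Finset.sum_congr rfl fun x hx ↦ ?_
  rw [← Finset.HasAntidiagonal.mem_antidiagonal.1 hx, pow_add]
  ring

theorem isBoundedAtImInfty (hf : HasQExpansion f φ) : IsBoundedAtImInfty f :=
  isBoundedAtImInfty_of_hasSum_qExpansion one_pos hf

theorem deriv (hf : HasQExpansion f φ) : HasQExpansion (D f) (theta φ) := fun τ ↦ by
  set F : ℕ → ℂ → ℂ := fun m z ↦ coeff m φ * 𝕢 1 z ^ m with hF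
  -- A point at half the height of `τ`: its series dominates the one at every `w` with larger
  -- imaginary part, which justifies termwise differentiation near `τ`.
  set ρ : ℍ := ⟨I * (τ.im / 2 : ℝ), by simpa using half_pos τ.im_pos⟩ with hρ
  set U : Set ℂ := {z | ρ.im < z.im} with hU
  have hUo : IsOpen U := isOpen_lt continuous_const Complex.continuous_im
  have hτ : (τ : ℂ) ∈ U := by
    have := τ.im_pos
    simpa [hU, hρ] using this
  have hd : ∀ m z, HasDerivAt (F m) (2 * π * I * (m * (coeff m φ * 𝕢 1 z ^ m))) z := by
    intro m z
    have h1 : F m = fun z ↦ coeff m φ * cexp (2 * π * I * m * z) := by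
      ext z
      simp only [hF, Function.Periodic.qParam, ← Complex.exp_nat_mul]
      congr 2
      push_cast
      ring
    have h2 : 𝕢 1 z ^ m = cexp (2 * π * I * m * z) := by
      simp only [Function.Periodic.qParam, ← Complex.exp_nat_mul]
      congr 1
      push_cast
      ring
    rw [h1, h2]
    have h3 : HasDerivAt (fun z : ℂ ↦ 2 * π * I * m * z) (2 * π * I * m) z := by
      simpa using (hasDerivAt_id z).const_mul (2 * π * I * m)
    exact (h3.cexp.const_mul (coeff m φ)).congr_deriv (by ring)
  have hle : ∀ m, ∀ w ∈ U, ‖F m w‖ ≤ ‖coeff m φ * 𝕢 1 ρ ^ m‖ := by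
    intro m w hw
    rw [norm_mul, norm_mul, norm_pow, norm_pow]
    gcongr
    rw [Function.Periodic.norm_qParam, Function.Periodic.norm_qParam]
    have : ρ.im < w.im := hw
    have h2 : (ρ : ℂ).im = ρ.im := rfl
    rw [h2]
    refine Real.exp_le_exp.2 ?_
    rw [div_one, div_one]
    nlinarith [Real.pi_pos]
  have h := hasSum_deriv_of_summable_norm (hf ρ).summable.norm
    (fun m z _ ↦ (hd m z).differentiableAt.differentiableWithinAt) hUo hle hτ
  have heq : f ∘ ofComplex =ᶠ[𝓝 (τ : ℂ)] fun z ↦ ∑' m, F m z := by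
    filter_upwards [isOpen_upperHalfPlaneSet.mem_nhds τ.im_pos] with z hz
    rw [Function.comp_apply, ofComplex_apply_of_im_pos hz]
    exact (hf ⟨z, hz⟩).tsum_eq.symm
  rw [← heq.deriv_eq] at h
  have h' := h.mul_left (2 * π * I)⁻¹
  refine h'.congr_fun fun m ↦ ?_
  rw [(hd m τ).deriv, coeff_theta, ← mul_assoc, inv_mul_cancel₀ (by simp [Real.pi_ne_zero])]
  ring

end HasQExpansion

theorem HasQExpansion.qExpansion_eq {k : ℤ} {f : ModularForm 𝒮ℒ k} {φ : ℂ⟦X⟧}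
    (h : HasQExpansion f φ) : qExpansion 1 f = φ := by
  ext m
  exact (ModularFormClass.qExpansion_coeff_unique one_pos one_mem_strictPeriods_SL h m).symm

/-- A modular form of level one, from a function with the right transformation behaviour that is
bounded at infinity. -/
def levelOneForm (k : ℤ) (f : ℍ → ℂ) (hf : ∀ γ : SL(2, ℤ), f ∣[k] γ = f) (hd : MDiff f)
    (hb : IsBoundedAtImInfty f) : ModularForm 𝒮ℒ k where
  toFun := f
  slash_action_eq' := by
    rintro _ ⟨γ, rfl⟩
    exact hf γ
  holo' := hd
  bdd_at_cusps' hc := by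
    rw [Subgroup.IsArithmetic.isCusp_iff_isCusp_SL2Z] at hc
    rw [OnePoint.isBoundedAt_iff_forall_SL2Z hc]
    intro γ _
    rwa [hf]

/-- The `q`-expansions of the modular forms of level one and weight `k`. -/
def modularSeries (k : ℕ) : Submodule ℂ ℂ⟦X⟧ where
  carrier := {φ | ∃ f : ModularForm 𝒮ℒ k, HasQExpansion f φ}
  add_mem' := by
    rintro _ _ ⟨f, hf⟩ ⟨g, hg⟩
    exact ⟨f + g, hf.add hg⟩
  zero_mem' := ⟨0, fun τ ↦ by simp⟩
  smul_mem' := by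
    rintro c _ ⟨f, hf⟩
    exact ⟨c • f, hf.smul c⟩

theorem one_mem_modularSeries : 1 ∈ modularSeries 0 :=
  ⟨(1 : ModularForm 𝒮ℒ 0), fun τ ↦ by
    convert hasSum_single (f := fun m : ℕ ↦ coeff m (1 : ℂ⟦X⟧) * 𝕢 1 τ ^ m) 0 ?_ using 1
    · simp
    · intro m hm
      simp [coeff_one, hm]⟩

theorem mul_mem_modularSeries {a b : ℕ} {φ ψ : ℂ⟦X⟧} (hφ : φ ∈ modularSeries a)
    (hψ : ψ ∈ modularSeries b) : φ * ψ ∈ modularSeries (a + b) := by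
  obtain ⟨f, hf⟩ := hφ
  obtain ⟨g, hg⟩ := hψ
  exact ⟨ModularForm.mcast (by push_cast; rfl) (f.mul g), hf.mul hg⟩

theorem hasQExpansion_E2 : HasQExpansion EisensteinSeries.E2 ((12 : ℂ) • eisensteinTwo) := by
  intro τ
  convert EisensteinSeries.hasSum_qExpansion_E2 (z := τ) using 2 with m
  rw [eisensteinTwo, coeff_smul, coeff_smul, map_sub, ← map_ofNat (C : ℂ →+* ℂ⟦X⟧), coeff_C_mul,
    sigmaSeries, coeff_mk, coeff_one]
  simp only [Function.Periodic.qParam, ofReal_one, div_one, smul_eq_mul, Rat.smul_def]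
  split_ifs with h
  · simp [h]
  · push_cast
    ring

/-- Boundedness at infinity is read off from the `q`-expansion of the Serre derivative. -/
theorem serre_mem_modularSeries {k : ℕ} {φ : ℂ⟦X⟧} (hφ : φ ∈ modularSeries k) :
    theta φ - (k : ℚ) • (eisensteinTwo * φ) ∈ modularSeries (k + 2) := by
  obtain ⟨f, hf⟩ := hφ
  have hd : MDiff (f : ℍ → ℂ) := f.holo'
  have h : HasQExpansion (serreDerivative (k : ℤ) f)
      (theta φ - (k : ℚ) • (eisensteinTwo * φ)) := by
    refine (hf.deriv.sub ((hasQExpansion_E2.mul hf).smul ((k : ℂ) * 12⁻¹))).congr ?_ ?_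
    · ext z
      simp [serreDerivative]
      ring
    · congr 1
      rw [smul_mul_assoc, smul_smul]
      ext m
      rw [coeff_smul, coeff_smul, Rat.smul_def]
      simp
  exact ⟨ModularForm.mcast (by push_cast; rfl) (levelOneForm ((k : ℤ) + 2) _
    (fun γ ↦ serreDerivative_slash_invariant hd (f.slash_action_eq' _ ⟨γ, rfl⟩))
    (serreDerivative_mdifferentiable _ hd) h.isBoundedAtImInfty), h⟩

theorem hasDerivAt_D2 (γ : SL(2, ℤ)) (z : ℍ) :
    HasDerivAt (EisensteinSeries.D2 γ ∘ ofComplex)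
      (-(2 * π * I) * (γ 1 0 / denom γ z) ^ 2) z := by
  have h := (hasDerivAt_denom_zpow (γ : GL (Fin 2) ℝ) (-1) z).const_mul (2 * π * I * γ 1 0)
  have heq : EisensteinSeries.D2 γ ∘ ofComplex =ᶠ[𝓝 (z : ℂ)]
      fun w ↦ 2 * π * I * γ 1 0 * denom (γ : GL (Fin 2) ℝ) w ^ (-1 : ℤ) := by
    filter_upwards [isOpen_upperHalfPlaneSet.mem_nhds z.im_pos] with w hw
    rw [Function.comp_apply, ofComplex_apply_of_im_pos hw, zpow_neg_one, ← div_eq_mul_inv]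
    rfl
  refine (h.congr_of_eventuallyEq heq).congr_deriv ?_
  have h10 : ((γ : GL (Fin 2) ℝ) 1 0 : ℂ) = γ 1 0 := by simp
  rw [h10, show (-1 - 1 : ℤ) = -2 by norm_num, zpow_neg, div_pow]
  norm_cast
  push_cast
  ring

theorem mdifferentiable_D2 (γ : SL(2, ℤ)) : MDiff (EisensteinSeries.D2 γ) := fun z ↦
  UpperHalfPlane.mdifferentiableAt_iff.mpr (hasDerivAt_D2 γ z).differentiableAt

theorem E2_slash_apply (γ : SL(2, ℤ)) (z : ℍ) : (EisensteinSeries.E2 ∣[(2 : ℤ)] γ) z =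
    EisensteinSeries.E2 z + 12 * (2 * π * I)⁻¹ * (γ 1 0 / denom γ z) := by
  rw [EisensteinSeries.E2_slash_action, riemannZeta_two]
  simp only [Pi.sub_apply, Pi.smul_apply, EisensteinSeries.D2, smul_eq_mul]
  have := Real.pi_ne_zero
  have hI : (I : ℂ)⁻¹ = -I := Complex.inv_I
  rw [mul_inv, hI]
  field_simp
  ring

/-- Differentiating `E₂|γ = E₂ + 12/(2πi) · c/(cz+d)` and squaring it produce the same anomalous
terms up to the factor 12, so they cancel. -/
theorem deriv_E2_sub_sq_slash (γ : SL(2, ℤ)) :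
    (D EisensteinSeries.E2 - (12⁻¹ : ℂ) • (EisensteinSeries.E2 * EisensteinSeries.E2)) ∣[(4 : ℤ)] γ =
      D EisensteinSeries.E2 - (12⁻¹ : ℂ) • (EisensteinSeries.E2 * EisensteinSeries.E2) := by
  have hE : MDiff EisensteinSeries.E2 := E2_mdifferentiable
  have h1 : D (EisensteinSeries.E2 ∣[(2 : ℤ)] γ) = D EisensteinSeries.E2 -
      (1 / (2 * riemannZeta 2)) • D (EisensteinSeries.D2 γ) := by
    rw [EisensteinSeries.E2_slash_action, normalizedDerivOfComplex_sub _ _ hE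
      ((mdifferentiable_D2 γ).const_smul _),
      normalizedDerivOfComplex_smul _ _ (mdifferentiable_D2 γ)]
  have h2 := normalizedDerivOfComplex_SL_slash (k := 2) hE (γ := γ)
  have h3 := ModularForm.mul_slash_SL2 2 2 γ EisensteinSeries.E2 EisensteinSeries.E2
  rw [sub_eq_add_neg, SlashAction.add_slash, SlashAction.neg_slash, SL_smul_slash,
    ← sub_eq_add_neg]
  rw [show (4 : ℤ) = 2 + 2 by norm_num, h3]
  ext z
  have h1z := congrFun h1 z
  have h2z := congrFun h2 z
  have h4 : D (EisensteinSeries.D2 γ) z = -(γ 1 0 / denom γ z) ^ 2 := by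
    rw [normalizedDerivOfComplex, (hasDerivAt_D2 γ z).deriv, neg_mul, mul_neg, ← mul_assoc,
      inv_mul_cancel₀ (by simp [Real.pi_ne_zero]), one_mul]
  have h5 : (1 / (2 * riemannZeta 2)) = -12 * ((2 * π * I)⁻¹) ^ 2 := by
    rw [riemannZeta_two]
    have := Real.pi_ne_zero
    rw [mul_inv, mul_pow, Complex.inv_I, neg_sq, Complex.I_sq]
    field_simp
    norm_num
  simp only [Pi.sub_apply, Pi.smul_apply, Pi.mul_apply, smul_eq_mul, h4, h5,
    E2_slash_apply, Int.cast_ofNat] at h1z h2z ⊢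
  change _ = D EisensteinSeries.E2 z - 12⁻¹ * (EisensteinSeries.E2 z * EisensteinSeries.E2 z)
  linear_combination h1z - h2z

/-- Ramanujan's identity for `D E₂`. Classically `w = -E₄/144`, but only its modularity matters. -/
theorem exists_mem_modularSeries_four_theta_eisensteinTwo :
    ∃ w ∈ modularSeries 4, theta eisensteinTwo = eisensteinTwo ^ 2 + w := by
  have h := hasQExpansion_E2.deriv.sub ((hasQExpansion_E2.mul hasQExpansion_E2).smul 12⁻¹)
  refine ⟨(12⁻¹ : ℂ) • _, Submodule.smul_mem _ _ ⟨levelOneForm 4 _ deriv_E2_sub_sq_slash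
    ((normalizedDerivOfComplex_mdifferentiable E2_mdifferentiable).sub
      ((E2_mdifferentiable.mul E2_mdifferentiable).const_smul _)) h.isBoundedAtImInfty, h⟩, ?_⟩
  ext m
  simp only [map_add, coeff_smul, map_sub, coeff_theta, smul_mul_assoc, mul_smul_comm,
    smul_eq_mul, pow_two]
  ring

end ModularSeries

/-! ### The Rankin-Cohen bracket of `η` and `1/η`, and its coefficients -/

section Bracket

open PowerSeries PartitionRecurrence Finset.HasAntidiagonal

theorem one_half_add_ne_zero (n : ℕ) : (1 / 2 : ℚ) + n ≠ 0 := by positivity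

theorem neg_one_half_add_ne_zero (n : ℕ) : (-1 / 2 : ℚ) + n ≠ 0 := by
  intro h
  have : (2 * n : ℚ) = 1 := by linarith
  norm_cast at this
  lia

/-- The equation for `1/η`, of weight -1/2, obtained by differentiating `η · (1/η) = 1`. -/
theorem theta_partitionSeries_add : theta partitionSeries + (-1 / 24 : ℚ) • partitionSeries =
    (-1 / 2 : ℚ) • (eisensteinTwo * partitionSeries) := by
  have h := pentagonalSeries_mul_partitionSeries
  have h1 := theta_pentagonalSeries_add
  have h2 := congrArg theta h
  rw [Derivation.leibniz, Derivation.map_one_eq_zero, smul_eq_mul, smul_eq_mul] at h2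
  rw [neg_div, neg_div, neg_smul, neg_smul]
  simp only [Algebra.smul_def] at h1 ⊢
  linear_combination partitionSeries * h2 - partitionSeries ^ 2 * h1 +
    (-theta partitionSeries + algebraMap ℚ ℂ⟦X⟧ (1 / 24) * partitionSeries -
      algebraMap ℚ ℂ⟦X⟧ (1 / 2) * eisensteinTwo * partitionSeries) * h

/-- The normalized `ν`-th Rankin-Cohen bracket of the eta function and its inverse. -/
noncomputable def etaBracket (ν : ℕ) : ℂ⟦X⟧ := ∑ x ∈ antidiagonal ν,
  (-1) ^ x.1 * ckCoeff theta eisensteinTwo (1 / 2) x.1 * ckCoeff theta eisensteinTwo (-1 / 2) x.2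

theorem etaBracket_mem (ν : ℕ) : etaBracket ν ∈ modularSeries (2 * ν) := by
  obtain ⟨w, hw, he⟩ := exists_mem_modularSeries_four_theta_eisensteinTwo
  have hmem : ∀ k : ℚ, (∀ n : ℕ, k + n ≠ 0) → ∀ n,
      coeff n (ckModular theta eisensteinTwo k) ∈ modularSeries (2 * n) := fun k hk n ↦
    coeff_ckModular_mem (fun a ↦ (modularSeries a).restrictScalars ℚ) one_mem_modularSeries
      (fun _ _ _ _ hf hg ↦ mul_mem_modularSeries hf hg) (fun _ _ hf ↦ serre_mem_modularSeries hf)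
      hw hk he n
  rw [etaBracket, sum_ckCoeff_mul]
  refine Submodule.sum_mem _ fun x hx ↦ ?_
  rw [← mem_antidiagonal.1 hx, mul_add, mul_assoc]
  have h := mul_mem_modularSeries (hmem _ one_half_add_ne_zero x.1)
    (hmem _ neg_one_half_add_ne_zero x.2)
  rcases neg_one_pow_eq_or ℂ⟦X⟧ x.1 with h1 | h1 <;> rw [h1]
  · rwa [one_mul]
  · rw [neg_one_mul]
    exact Submodule.neg_mem _ h

/-- The weights of the coefficients in `etaBracket`. -/
noncomputable def bracketWeight (ν : ℕ) (a b : ℚ) : ℚ := ∑ x ∈ antidiagonal ν,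
  (-1) ^ x.1 * (ckFactor (1 / 2) x.1 * ckFactor (-1 / 2) x.2)⁻¹ * a ^ x.1 * b ^ x.2

theorem coeff_etaBracket (ν n : ℕ) : coeff n (etaBracket ν) = ∑ y ∈ antidiagonal n,
    (bracketWeight ν (y.1 + 1 / 24) (y.2 - 1 / 24) : ℂ) * coeff y.1 (pentagonalSeries ℂ) *
      coeff y.2 partitionSeries := by
  have h : etaBracket ν = ∑ x ∈ antidiagonal ν,
      ((-1) ^ x.1 * (ckFactor (1 / 2) x.1 * ckFactor (-1 / 2) x.2)⁻¹ : ℚ) •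
        ((fun f ↦ theta f + (1 / 24 : ℚ) • f)^[x.1] (pentagonalSeries ℂ) *
          (fun f ↦ theta f + (-1 / 24 : ℚ) • f)^[x.2] partitionSeries) := by
    refine Finset.sum_congr rfl fun x _ ↦ ?_
    rw [iterate_twisted_derivation one_half_add_ne_zero theta_pentagonalSeries_add,
      iterate_twisted_derivation neg_one_half_add_ne_zero theta_partitionSeries_add,
      smul_mul_smul_comm, smul_smul, mul_assoc ((-1 : ℚ) ^ x.1), inv_mul_cancel₀, mul_one, Algebra.smul_def]
    · simp only [map_pow, map_neg, map_one]
      -- The prefactors `f` and `1/f` left by the two iterated derivations multiply to 1.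
      linear_combination -(-1) ^ x.1 * ckCoeff theta eisensteinTwo (1 / 2) x.1 *
        ckCoeff theta eisensteinTwo (-1 / 2) x.2 * pentagonalSeries_mul_partitionSeries
    · exact mul_ne_zero (ckFactor_ne_zero one_half_add_ne_zero _)
        (ckFactor_ne_zero neg_one_half_add_ne_zero _)
  rw [h, map_sum]
  simp only [coeff_smul, coeff_mul, coeff_iterate_theta_add, Finset.smul_sum, bracketWeight]
  rw [Finset.sum_comm]
  refine Finset.sum_congr rfl fun y _ ↦ ?_
  push_cast
  rw [Finset.sum_mul, Finset.sum_mul]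
  refine Finset.sum_congr rfl fun x _ ↦ ?_
  rw [Rat.smul_def]
  push_cast
  ring

theorem ckFactor_one_half (n : ℕ) : ckFactor (1 / 2) n = (2 * n).factorial / 4 ^ n := by
  induction n with
  | zero => simp [ckFactor]
  | succ n ih =>
    rw [ckFactor_succ, ih, show 2 * (n + 1) = 2 * n + 1 + 1 by ring, Nat.factorial_succ,
      Nat.factorial_succ]
    push_cast
    field_simp
    ring

theorem two_mul_sub_one_ne_zero (n : ℕ) : (2 * n - 1 : ℚ) ≠ 0 := by
  have := neg_one_half_add_ne_zero n
  contrapose! this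
  linarith

theorem ckFactor_neg_one_half (n : ℕ) :
    ckFactor (-1 / 2) n = -((2 * n).factorial / (4 ^ n * (2 * n - 1))) := by
  induction n with
  | zero => simp [ckFactor]
  | succ n ih =>
    rw [ckFactor_succ, ih, show 2 * (n + 1) = 2 * n + 1 + 1 by ring, Nat.factorial_succ,
      Nat.factorial_succ]
    have h1 := two_mul_sub_one_ne_zero n
    have h2 := two_mul_sub_one_ne_zero (n + 1)
    push_cast at h2 ⊢
    field_simp
    ring

/-- The constant factor of `g`. -/
def gFactor (ν : ℕ) : ℚ := (2 * (ν : ℚ) - 1) *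
  fallingFactorial (2 * (ν : ℚ) - 2) ((ν : ℤ) - 1) ^ 2 / (2 : ℚ) ^ (2 * (ν : ℤ) - 2)

/-- Here `-6 = -24/4`: the 24 clears the denominators of the two arguments, and the 4 absorbs the
powers of 4 in `ckFactor (±1/2)`. The outer sign is that of `ckFactor (-1/2)`. -/
theorem g_eq_bracketWeight (ν : ℕ) (n k : ℤ) : g ν n k = -(gFactor ν * (-6) ^ ν) *
    bracketWeight ν ((6 * k + 1) ^ 2 / 24) ((24 * n - (6 * k + 1) ^ 2) / 24) := by
  rw [g, ← gFactor, ← mul_neg, mul_assoc, bracketWeight,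
    Finset.Nat.sum_antidiagonal_eq_sum_range_succ_mk]
  congr 1
  rw [Finset.mul_sum]
  refine Finset.sum_congr rfl fun r hr ↦ ?_
  have hr : r ≤ ν := Nat.lt_succ_iff.1 (Finset.mem_range.1 hr)
  obtain ⟨s, rfl⟩ := Nat.exists_eq_add_of_le hr
  simp only [Nat.add_sub_cancel_left, ckFactor_one_half, ckFactor_neg_one_half,
    show 2 * (r + s) - 2 * r = 2 * s by lia]
  have h1 := two_mul_sub_one_ne_zero s
  rw [show (2 * ((r + s : ℕ) : ℚ) - 2 * r - 1) = 2 * s - 1 by push_cast; ring, div_pow, div_pow,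
    ← pow_mul, show (-6 : ℚ) ^ (r + s) = (-1) ^ (r + s) * 24 ^ r * 24 ^ s / (4 ^ r * 4 ^ s) by
      rw [mul_assoc, ← pow_add, ← pow_add, ← mul_pow, ← div_pow]; norm_num]
  have h2 : ((2 * r).factorial : ℚ) ≠ 0 := by positivity
  have h3 : ((2 * s).factorial : ℚ) ≠ 0 := by positivity
  field_simp
  ring

/-- The full sum over all integers `k` attached to the recurrence. -/
noncomputable def recurrenceSum (ν n : ℕ) : ℚ := g ν n 0 * p n - pentagonalSum ν n

theorem recurrenceSum_eq (ν n : ℕ) : recurrenceSum ν n =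
    ∑ k ∈ Finset.Icc (-(n : ℤ)) n, (-1 : ℚ) ^ k * g ν n k * p (n - omega k) := by
  have h0 : (0 : ℤ) ∈ Finset.Icc (-(n : ℤ)) n := by simp
  rw [← Finset.add_sum_erase _ _ h0, recurrenceSum, pentagonalSum, sub_eq_add_neg]
  congr 1
  · simp [omega]
  · refine (congrArg Neg.neg (finsum_cond_eq_sum_of_cond_iff (p := (· ≠ 0)) _
      (t := (Finset.Icc (-(n : ℤ)) n).erase 0) ?_)).trans ?_
    rotate_left
    · rw [← Finset.sum_neg_distrib]
      refine Finset.sum_congr rfl fun k _ ↦ ?_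
      rw [zpow_add₀ (by norm_num)]
      ring
    · intro k hk
      simp only [Finset.mem_erase, Finset.mem_Icc, ne_eq, iff_self_and]
      intro _
      rw [← abs_le]
      by_contra hlt
      apply hk
      have := abs_le_omega k
      have hp : p (n - omega k) = 0 := if_neg (by linarith)
      simp [hp]

theorem coeff_etaBracket_eq_recurrenceSum (ν n : ℕ) :
    (recurrenceSum ν n : ℂ) = -(gFactor ν * (-6) ^ ν : ℚ) * coeff n (etaBracket ν) := by
  -- `pentagonal` uses the convention `k(3k-1)/2`, hence the change of sign in `k`.
  have hω : ∀ k : ℤ, (pentagonal (-k) : ℤ) = omega k := fun k ↦ by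
    have := two_mul_natCast_pentagonal_neg k
    have := two_mul_omega k
    linarith
  rw [coeff_etaBracket, Finset.Nat.sum_antidiagonal_eq_sum_range_succ_mk, recurrenceSum_eq,
    ← Finset.sum_filter_of_ne (p := fun k ↦ omega k ≤ n)]
  · push_cast
    rw [Finset.mul_sum]
    refine Finset.sum_of_injOn (fun k ↦ pentagonal (-k)) ?_ ?_ ?_ ?_
    · exact fun a _ b _ h ↦ neg_injective (pentagonal_injective h)
    · intro k hk
      have := (Finset.mem_filter.1 hk).2
      simp only [Finset.coe_range, Set.mem_Iio]
      have := hω k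
      lia
    · intro i hi hik
      rw [coeff_pentagonalSeries_eq_zero]
      · ring
      · rintro ⟨k, rfl⟩
        refine hik ⟨-k, ?_, by simp⟩
        have h1 := hω (-k)
        rw [neg_neg] at h1
        have h2 := Finset.mem_range.1 hi
        have h3 := abs_le_omega (-k)
        simp only [Finset.coe_filter, Finset.mem_Icc, Set.mem_ofPred_eq]
        rw [← abs_le]
        constructor <;> lia
    · intro k hk
      have hk := (Finset.mem_filter.1 hk).2
      have h1 := hω k
      have h2 : (pentagonal (-k) : ℚ) = (3 * k ^ 2 + k) / 2 := by
        have := two_mul_omega k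
        rw [← h1] at this
        have : (2 * pentagonal (-k) : ℚ) = 3 * k ^ 2 + k := by exact_mod_cast this
        linarith
      have h3 : ((n - pentagonal (-k) : ℕ) : ℚ) = n - pentagonal (-k) := by
        rw [Nat.cast_sub (by lia)]
      have h4 : p (n - omega k) = Fintype.card (Nat.Partition (n - pentagonal (-k))) := by
        rw [p, if_pos (by lia), ← h1, show ((n : ℤ) - pentagonal (-k)).toNat = n - pentagonal (-k) by lia]
      simp only [coeff_pentagonalSeries_pentagonal, partitionSeries, coeff_mk, h3, h2,
        g_eq_bracketWeight, h4, Int.negOnePow_neg, Int.cast_negOnePow]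
      rw [show ((6 * k + 1) ^ 2 / 24 : ℚ) = (3 * k ^ 2 + k) / 2 + 1 / 24 by ring,
        show ((24 * (n : ℤ) - (6 * k + 1) ^ 2) / 24 : ℚ) =
          n - (3 * k ^ 2 + k) / 2 - 1 / 24 by push_cast; ring]
      push_cast
      ring
  · intro k _ hk
    by_contra hlt
    apply hk
    have hp : p (n - omega k) = 0 := if_neg (by linarith)
    simp [hp]

end Bracket

/-! ### Bernoulli numbers, one-dimensional cusp spaces and the recurrence -/

section Recurrence

open UpperHalfPlane hiding I
open PowerSeries ModularForm PartitionRecurrence Finset.HasAntidiagonal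

theorem bernoulli'_odd_eq_zero (n : ℕ) : bernoulli' (2 * n + 3) = 0 :=
  bernoulli'_eq_zero_of_odd ⟨n + 1, by ring⟩ (by lia)

theorem bernoulli_even_values : bernoulli 12 = -691 / 2730 ∧
    bernoulli 16 = -3617 / 510 ∧
    bernoulli 18 = 43867 / 798 ∧
    bernoulli 20 = -174611 / 330 ∧
    bernoulli 22 = 854513 / 138 ∧
    bernoulli 26 = 8553103 / 6 := by
  have h3 := bernoulli'_odd_eq_zero 0
  have h5 := bernoulli'_odd_eq_zero 1
  have h7 := bernoulli'_odd_eq_zero 2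
  have h9 := bernoulli'_odd_eq_zero 3
  have h11 := bernoulli'_odd_eq_zero 4
  have h13 := bernoulli'_odd_eq_zero 5
  have h15 := bernoulli'_odd_eq_zero 6
  have h17 := bernoulli'_odd_eq_zero 7
  have h19 := bernoulli'_odd_eq_zero 8
  have h21 := bernoulli'_odd_eq_zero 9
  have h23 := bernoulli'_odd_eq_zero 10
  have h25 := bernoulli'_odd_eq_zero 11
  norm_num at h3 h5 h7 h9 h11 h13 h15 h17 h19 h21 h23 h25
  have h6 : bernoulli' 6 = 1 / 42 := by
    have h := sum_bernoulli' 7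
    norm_num [Finset.sum_range_succ, Nat.choose, bernoulli'_zero, bernoulli'_one, bernoulli'_two, bernoulli'_four, h3, h5] at h
    linarith
  have h8 : bernoulli' 8 = -1 / 30 := by
    have h := sum_bernoulli' 9
    norm_num [Finset.sum_range_succ, Nat.choose, bernoulli'_zero, bernoulli'_one, bernoulli'_two, bernoulli'_four, h3, h5, h6, h7] at h
    linarith
  have h10 : bernoulli' 10 = 5 / 66 := by
    have h := sum_bernoulli' 11
    norm_num [Finset.sum_range_succ, Nat.choose, bernoulli'_zero, bernoulli'_one, bernoulli'_two, bernoulli'_four, h3, h5, h6, h7, h8, h9] at h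
    linarith
  have h12 : bernoulli' 12 = -691 / 2730 := by
    have h := sum_bernoulli' 13
    norm_num [Finset.sum_range_succ, Nat.choose, bernoulli'_zero, bernoulli'_one, bernoulli'_two, bernoulli'_four, h3, h5, h6, h7, h8, h9, h10, h11] at h
    linarith
  have h14 : bernoulli' 14 = 7 / 6 := by
    have h := sum_bernoulli' 15
    norm_num [Finset.sum_range_succ, Nat.choose, bernoulli'_zero, bernoulli'_one, bernoulli'_two, bernoulli'_four, h3, h5, h6, h7, h8, h9, h10, h11, h12, h13] at h
    linarith
  have h16 : bernoulli' 16 = -3617 / 510 := by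
    have h := sum_bernoulli' 17
    norm_num [Finset.sum_range_succ, Nat.choose, bernoulli'_zero, bernoulli'_one, bernoulli'_two, bernoulli'_four, h3, h5, h6, h7, h8, h9, h10, h11, h12, h13, h14, h15] at h
    linarith
  have h18 : bernoulli' 18 = 43867 / 798 := by
    have h := sum_bernoulli' 19
    norm_num [Finset.sum_range_succ, Nat.choose, bernoulli'_zero, bernoulli'_one, bernoulli'_two, bernoulli'_four, h3, h5, h6, h7, h8, h9, h10, h11, h12, h13, h14, h15, h16, h17] at h
    linarith
  have h20 : bernoulli' 20 = -174611 / 330 := by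
    have h := sum_bernoulli' 21
    norm_num [Finset.sum_range_succ, Nat.choose, bernoulli'_zero, bernoulli'_one, bernoulli'_two, bernoulli'_four, h3, h5, h6, h7, h8, h9, h10, h11, h12, h13, h14, h15, h16, h17, h18, h19] at h
    linarith
  have h22 : bernoulli' 22 = 854513 / 138 := by
    have h := sum_bernoulli' 23
    norm_num [Finset.sum_range_succ, Nat.choose, bernoulli'_zero, bernoulli'_one, bernoulli'_two, bernoulli'_four, h3, h5, h6, h7, h8, h9, h10, h11, h12, h13, h14, h15, h16, h17, h18, h19, h20, h21] at h
    linarith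
  have h24 : bernoulli' 24 = -236364091 / 2730 := by
    have h := sum_bernoulli' 25
    norm_num [Finset.sum_range_succ, Nat.choose, bernoulli'_zero, bernoulli'_one, bernoulli'_two, bernoulli'_four, h3, h5, h6, h7, h8, h9, h10, h11, h12, h13, h14, h15, h16, h17, h18, h19, h20, h21, h22, h23] at h
    linarith
  have h26 : bernoulli' 26 = 8553103 / 6 := by
    have h := sum_bernoulli' 27
    norm_num [Finset.sum_range_succ, Nat.choose, bernoulli'_zero, bernoulli'_one, bernoulli'_two, bernoulli'_four, h3, h5, h6, h7, h8, h9, h10, h11, h12, h13, h14, h15, h16, h17, h18, h19, h20, h21, h22, h23, h24, h25] at h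
    linarith
  simp only [bernoulli, h12, h16, h18, h20, h22, h26]
  norm_num

theorem qExpansion_discriminant_mul {k : ℤ} (f : ModularForm 𝒮ℒ k) :
    qExpansion 1 (discriminant * ⇑f : ℍ → ℂ) = qExpansion 1 discriminant * qExpansion 1 f := by
  rw [← CuspForm.coe_discriminant]
  exact ModularForm.qExpansion_mul_coe one_pos one_mem_strictPeriods_SL _ _

/-- Division by `Δ` identifies cusp forms of weight `2ν` with modular forms of weight `j = 2ν - 12`,
a line spanned by `f`. -/
theorem exists_cuspForm_eq_cuspDelta {ν j : ℕ} (hj : 2 * ν = 12 + j)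
    (hrank : Module.rank ℂ (ModularForm 𝒮ℒ (j : ℤ)) = 1) (f : ModularForm 𝒮ℒ (j : ℤ))
    (hf : (qExpansion 1 f).coeff 0 = 1) (hcusp : cuspDelta ν = discriminant * ⇑f) :
    ∃ F : CuspForm 𝒮ℒ (2 * (ν : ℤ)), (F : ℍ → ℂ) = cuspDelta ν ∧ tau ν 1 = 1 ∧
      ∀ h : CuspForm 𝒮ℒ (2 * (ν : ℤ)), ∃ c : ℂ, h = c • F := by
  have hk : (2 * (ν : ℤ)) = 12 + j := by exact_mod_cast hj
  refine ⟨CuspForm.mcast hk.symm (CuspForm.discriminant.mulModularForm f), hcusp.symm, ?_, ?_⟩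
  · rw [tau, hcusp, qExpansion_discriminant_mul, coeff_mul, Finset.Nat.antidiagonal_succ]
    have h0 : (qExpansion 1 discriminant).coeff 0 = 0 :=
      CuspFormClass.qExpansion_coeff_zero CuspForm.discriminant one_pos one_mem_strictPeriods_SL
    simp only [Finset.Nat.antidiagonal_zero, Finset.map_singleton, Finset.sum_cons,
      Finset.sum_singleton, h0, zero_mul, zero_add]
    change coeff 1 (qExpansion 1 discriminant) * coeff 0 (qExpansion 1 f) = 1
    rw [discriminant_qExpansion_coeff_one, hf, one_mul]
  · intro h
    have hf0 : f ≠ 0 := by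
      rintro rfl
      simp [qExpansion_zero] at hf
    obtain ⟨c, hc⟩ := (finrank_eq_one_iff_of_nonzero' f hf0).mp
      (Module.rank_eq_one_iff_finrank_eq_one.mp hrank)
      (ModularForm.mcast (by lia) (CuspForm.discriminantEquiv h))
    refine ⟨c, DFunLike.ext _ _ fun z ↦ ?_⟩
    have hz : c * f z = h z / discriminant z := DFunLike.congr_fun hc z
    change h z = c * (discriminant z * f z)
    rw [mul_left_comm, hz, mul_div_cancel₀ _ (discriminant_ne_zero z)]

/-- Subtracting the multiple of `E_{2ν}` with the same constant term leaves a cusp form `c Δ_{2ν}`,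
and the coefficient at 1 determines `c`. -/
theorem coeff_eq_of_mem_modularSeries {ν : ℕ} (hν : 3 ≤ 2 * ν) {φ : ℂ⟦X⟧}
    (hφ : φ ∈ modularSeries (2 * ν)) {F : CuspForm 𝒮ℒ (2 * (ν : ℤ))}
    (hF : (F : ℍ → ℂ) = cuspDelta ν) (hone : tau ν 1 = 1)
    (hspan : ∀ h : CuspForm 𝒮ℒ (2 * (ν : ℤ)), ∃ c : ℂ, h = c • F) {n : ℕ} (hn : n ≠ 0) :
    coeff n φ = coeff 0 φ * (-(4 * ν) / bernoulli (2 * ν) *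
        (ArithmeticFunction.sigma (2 * ν - 1) n : ℂ)) +
      (coeff 1 φ + coeff 0 φ * (4 * ν / bernoulli (2 * ν))) * tau ν n := by
  obtain ⟨f, hf⟩ := hφ
  have hfφ := hf.qExpansion_eq
  have hE := EisensteinSeries.E_qExpansion_coeff hν ⟨ν, two_mul ν⟩
  set E := ModularForm.E hν
  have hq : qExpansion 1 (f - coeff 0 φ • E : ModularForm 𝒮ℒ ((2 * ν : ℕ) : ℤ)) =
      φ - coeff 0 φ • qExpansion 1 E := by
    have h := (ModularForm.qExpansion_sub one_pos one_mem_strictPeriods_SL f (coeff 0 φ • E)).trans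
      (congrArg _ (ModularForm.qExpansion_smul one_pos one_mem_strictPeriods_SL _ E))
    rwa [hfφ] at h
  have h0 : (qExpansion 1 (f - coeff 0 φ • E : ModularForm 𝒮ℒ ((2 * ν : ℕ) : ℤ))).coeff 0 = 0 := by
    rw [hq, map_sub, coeff_smul, hE]
    simp
  obtain ⟨c, hc⟩ := hspan (CuspForm.mcast (by push_cast; rfl) (toCuspForm _ h0))
  have hqc : qExpansion 1 (f - coeff 0 φ • E : ModularForm 𝒮ℒ ((2 * ν : ℕ) : ℤ)) =
      c • qExpansion 1 (cuspDelta ν) := by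
    rw [← hF, ← ModularForm.qExpansion_smul one_pos one_mem_strictPeriods_SL c F]
    exact congrArg (qExpansion 1) (congrArg DFunLike.coe hc)
  rw [hq] at hqc
  have hcoeff : ∀ m, coeff m φ - coeff 0 φ * coeff m (qExpansion 1 E) = c * tau ν m := fun m ↦ by
    simpa [tau] using congrArg (coeff m) hqc
  have h1 := hcoeff 1
  have h2 := hcoeff n
  rw [hone] at h1
  rw [hE, if_neg hn] at h2
  rw [hE, if_neg one_ne_zero] at h1
  simp only [ArithmeticFunction.sigma_one, Nat.cast_one] at h1
  push_cast at h1 h2 ⊢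
  linear_combination h2 - tau ν n * h1

theorem recurrenceSum_eq_of_cuspForm {ν : ℕ} (hν : 3 ≤ 2 * ν) {F : CuspForm 𝒮ℒ (2 * (ν : ℤ))}
    (hF : (F : ℍ → ℂ) = cuspDelta ν) (hone : tau ν 1 = 1)
    (hspan : ∀ h : CuspForm 𝒮ℒ (2 * (ν : ℤ)), ∃ c : ℂ, h = c • F) {n : ℕ} (hn : n ≠ 0) :
    (recurrenceSum ν n : ℂ) = recurrenceSum ν 0 * (-(4 * ν) / bernoulli (2 * ν) *
        (ArithmeticFunction.sigma (2 * ν - 1) n : ℂ)) +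
      (recurrenceSum ν 1 + recurrenceSum ν 0 * (4 * ν / bernoulli (2 * ν)) : ℚ) * tau ν n := by
  have h := coeff_eq_of_mem_modularSeries hν (etaBracket_mem ν) hF hone hspan hn
  push_cast
  rw [coeff_etaBracket_eq_recurrenceSum, coeff_etaBracket_eq_recurrenceSum,
    coeff_etaBracket_eq_recurrenceSum, h]
  ring

theorem recurrenceSum_zero (ν : ℕ) : recurrenceSum ν 0 = g ν 0 0 := by
  rw [recurrenceSum_eq]
  simp [omega, p]

/-- Only `ω(0) = 0` and `ω(-1) = 1` are at most 1. -/
theorem recurrenceSum_one (ν : ℕ) : recurrenceSum ν 1 = g ν 1 0 - g ν 1 (-1) := by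
  rw [recurrenceSum_eq, show Finset.Icc (-((1 : ℕ) : ℤ)) (1 : ℕ) = {-1, 0, 1} from rfl]
  simp [omega, p]
  ring

theorem fallingFactorial_ne_zero {ν : ℕ} (hν : 2 ≤ ν) :
    fallingFactorial (2 * (ν : ℚ) - 2) ((ν : ℤ) - 1) ≠ 0 := by
  obtain ⟨m, rfl⟩ := Nat.exists_eq_add_of_le' (show 1 ≤ ν by lia)
  rw [show ((m + 1 : ℕ) : ℤ) - 1 = Int.ofNat m by simp]
  refine Finset.prod_ne_zero_iff.2 fun i hi ↦ ?_
  have hi := Finset.mem_range.1 hi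
  have : (i + 1 : ℚ) ≤ m := by exact_mod_cast hi
  have : (0 : ℚ) ≤ i := by positivity
  push_cast
  intro h
  linarith

theorem gFactor_ne_zero {ν : ℕ} (hν : 2 ≤ ν) : gFactor ν ≠ 0 :=
  div_ne_zero (mul_ne_zero (two_mul_sub_one_ne_zero ν)
    (pow_ne_zero _ (fallingFactorial_ne_zero hν))) (zpow_ne_zero _ two_ne_zero)

theorem g_eq_gFactor_mul (ν : ℕ) (n k : ℤ) : g ν n k = gFactor ν * ((∑ r ∈ Finset.range (ν + 1),
    (-1) ^ (ν + r) * (2 * ν - 2 * r - 1) * (2 * ν).choose (2 * r) * (6 * k + 1) ^ (2 * r) *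
      (24 * n - (6 * k + 1) ^ 2) ^ (ν - r) : ℤ) / (2 * ν).factorial) := by
  rw [g, ← gFactor]
  push_cast
  rw [Finset.sum_div]
  congr 1
  refine Finset.sum_congr rfl fun r hr ↦ ?_
  have hr : r ≤ ν := Nat.lt_succ_iff.1 (Finset.mem_range.1 hr)
  rw [Nat.cast_choose ℚ (show 2 * r ≤ 2 * ν by lia)]
  have h1 : ((2 * ν).factorial : ℚ) ≠ 0 := by positivity
  field_simp

/-- Modulo `24n - 1` only the term `r = ν` of the integral sum survives, and it equals -1. Vanishing
would force `24n - 1` to divide 1. -/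
theorem g_zero_ne_zero {ν n : ℕ} (hν : 2 ≤ ν) (hn : 1 ≤ n) : g ν n 0 ≠ 0 := by
  rw [g_eq_gFactor_mul]
  refine mul_ne_zero (gFactor_ne_zero hν) (div_ne_zero (Int.cast_ne_zero.2 fun h ↦ ?_)
    (by positivity))
  rw [Finset.sum_range_succ] at h
  simp only [mul_zero, zero_add, one_pow, mul_one] at h
  have hdvd : (24 * n - 1 : ℤ) ∣ 1 := by
    have h2 : (24 * n - 1 : ℤ) ∣ ∑ r ∈ Finset.range ν, (-1) ^ (ν + r) *
        (2 * (ν : ℤ) - 2 * r - 1) * (2 * ν).choose (2 * r) * (24 * n - 1) ^ (ν - r) :=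
      Finset.dvd_sum fun r hr ↦ Dvd.dvd.mul_left
        (dvd_pow_self _ (Nat.sub_ne_zero_of_lt (Finset.mem_range.1 hr))) _
    rw [← two_mul ν, pow_mul, neg_one_sq] at h
    simp only [one_pow, Nat.choose_self, Nat.sub_self, pow_zero] at h
    convert h2 using 1
    push_cast at h
    linarith
  have := Int.le_of_dvd one_pos hdvd
  lia

theorem recurrence {ν : ℕ} (hν : 2 ≤ ν) {F : CuspForm 𝒮ℒ (2 * (ν : ℤ))}
    (hF : (F : ℍ → ℂ) = cuspDelta ν) (hone : tau ν 1 = 1)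
    (hspan : ∀ h : CuspForm 𝒮ℒ (2 * (ν : ℤ)), ∃ c : ℂ, h = c • F)
    (h0 : g ν 0 0 = (2 * ν - 2).choose (ν - 2))
    (h1 : g ν 1 0 - g ν 1 (-1) + g ν 0 0 * (4 * ν / bernoulli (2 * ν)) = beta ν)
    {n : ℕ} (hn : 1 ≤ n) :
    g ν n 0 ≠ 0 ∧ (p n : ℂ) = 1 / (g ν n 0 : ℂ) *
      (-(4 * (ν : ℂ)) / (bernoulli (2 * ν) : ℂ) * ((2 * ν - 2).choose (ν - 2) : ℂ)
          * (ArithmeticFunction.sigma (2 * ν - 1) n : ℂ)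
        + (beta ν : ℂ) * tau ν n + (pentagonalSum ν n : ℂ)) := by
  have hg := g_zero_ne_zero hν hn
  refine ⟨hg, ?_⟩
  have h := recurrenceSum_eq_of_cuspForm (by lia) hF hone hspan (show n ≠ 0 by lia)
  rw [recurrenceSum_one, recurrenceSum_zero, h1, h0, recurrenceSum] at h
  have hgC : (g ν n 0 : ℂ) ≠ 0 := by exact_mod_cast hg
  push_cast at h
  rw [one_div, eq_inv_mul_iff_mul_eq₀ hgC]
  linear_combination h

theorem exists_cuspForm_and_recurrence {ν j : ℕ} (hj : 2 * ν = 12 + j)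
    (hrank : Module.rank ℂ (ModularForm 𝒮ℒ (j : ℤ)) = 1) (f : ModularForm 𝒮ℒ (j : ℤ))
    (hf : (qExpansion 1 f).coeff 0 = 1) (hcusp : cuspDelta ν = discriminant * ⇑f)
    (h0 : g ν 0 0 = (2 * ν - 2).choose (ν - 2))
    (h1 : g ν 1 0 - g ν 1 (-1) + g ν 0 0 * (4 * ν / bernoulli (2 * ν)) = beta ν) :
    (∃ f : CuspForm 𝒮ℒ (2 * (ν : ℤ)), (f : ℍ → ℂ) = cuspDelta ν ∧ tau ν 1 = 1 ∧
      ∀ h : CuspForm 𝒮ℒ (2 * (ν : ℤ)), ∃ c : ℂ, h = c • f) ∧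
    ∀ n : ℕ, 1 ≤ n → g ν n 0 ≠ 0 ∧ (p n : ℂ) = 1 / (g ν n 0 : ℂ) *
      (-(4 * (ν : ℂ)) / (bernoulli (2 * ν) : ℂ) * ((2 * ν - 2).choose (ν - 2) : ℂ)
          * (ArithmeticFunction.sigma (2 * ν - 1) n : ℂ)
        + (beta ν : ℂ) * tau ν n + (pentagonalSum ν n : ℂ)) := by
  obtain ⟨F, hF, hone, hspan⟩ := exists_cuspForm_eq_cuspDelta hj hrank f hf hcusp
  exact ⟨⟨F, hF, hone, hspan⟩, fun n hn ↦ recurrence (by lia) hF hone hspan h0 h1 hn⟩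

theorem E₄_qExpansion_coeff_zero : (qExpansion 1 E₄).coeff 0 = 1 :=
  EisensteinSeries.E_qExpansion_coeff_zero _ ⟨2, rfl⟩

theorem E₆_qExpansion_coeff_zero : (qExpansion 1 E₆).coeff 0 = 1 :=
  EisensteinSeries.E_qExpansion_coeff_zero _ ⟨3, rfl⟩

theorem qExpansion_mul_coeff_zero_eq_one {a b : ℤ} {f : ModularForm 𝒮ℒ a} {h : ModularForm 𝒮ℒ b}
    (hf : (qExpansion 1 f).coeff 0 = 1) (hh : (qExpansion 1 h).coeff 0 = 1) :
    (qExpansion 1 (f.mul h)).coeff 0 = 1 := by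
  rw [ModularForm.qExpansion_mul one_pos one_mem_strictPeriods_SL, coeff_mul,
    Finset.Nat.antidiagonal_zero, Finset.sum_singleton, hf, hh, one_mul]

end Recurrence

/-! ### Numerical constants, integrality of `τ` and the congruence -/

section RamanujanTau

open UpperHalfPlane hiding I
open PowerSeries ModularForm PartitionRecurrence

theorem g_zero_zero_eq_choose {ν : ℕ} (hν : ν ∈ ({6, 8, 9, 10, 11, 13} : Set ℕ)) :
    g ν 0 0 = (2 * ν - 2).choose (ν - 2) := by
  rcases hν with rfl | rfl | rfl | rfl | rfl | rfl <;>
  norm_num [g, fallingFactorial, Finset.sum_range_succ, Nat.factorial, Finset.prod_range_succ,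
    Nat.choose]

/-- `β_ν` is the coefficient of `Δ_{2ν}`: the value of the full sum at `n = 1` minus the Eisenstein
contribution. The denominators are the numerators of `B_{2ν}` up to sign, after cancelling 11 for `ν
= 11` and 13 for `ν = 13`. -/
theorem beta_eq {ν : ℕ} (hν : ν ∈ ({6, 8, 9, 10, 11, 13} : Set ℕ)) :
    g ν 1 0 - g ν 1 (-1) + g ν 0 0 * (4 * ν / bernoulli (2 * ν)) = beta ν := by
  obtain ⟨h6, h8, h9, h10, h11, h13⟩ := bernoulli_even_values
  rw [g_zero_zero_eq_choose hν]
  rcases hν with rfl | rfl | rfl | rfl | rfl | rfl <;>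
  norm_num [g, fallingFactorial, Finset.sum_range_succ, Nat.factorial, Finset.prod_range_succ,
    Nat.choose, beta, h6, h8, h9, h10, h11, h13]

theorem exists_modularForm_cuspDelta_eq {ν : ℕ} (hν : ν ∈ ({6, 8, 9, 10, 11, 13} : Set ℕ)) :
    ∃ j : ℕ, 2 * ν = 12 + j ∧ Module.rank ℂ (ModularForm 𝒮ℒ (j : ℤ)) = 1 ∧
      ∃ f : ModularForm 𝒮ℒ (j : ℤ), (qExpansion 1 f).coeff 0 = 1 ∧
        cuspDelta ν = discriminant * ⇑f := by
  have hrank : ∀ j ∈ ({0, 4, 6, 8, 10, 14} : Finset ℕ),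
      Module.rank ℂ (ModularForm 𝒮ℒ (j : ℤ)) = 1 := by
    intro j hj
    rw [dimension_level_one j (by revert j; decide)]
    exact_mod_cast show (if j ≡ 2 [MOD 12] then j / 12 else j / 12 + 1) = 1 by revert j; decide
  have h4 := E₄_qExpansion_coeff_zero
  have h6 := E₆_qExpansion_coeff_zero
  rcases hν with rfl | rfl | rfl | rfl | rfl | rfl
  · exact ⟨0, rfl, hrank 0 (by decide), (1 : ModularForm 𝒮ℒ 0), by simp [qExpansion_one],
      by ext z; simp [cuspDelta]⟩
  · exact ⟨4, rfl, hrank 4 (by decide), E₄, h4, rfl⟩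
  · exact ⟨6, rfl, hrank 6 (by decide), E₆, h6, rfl⟩
  · exact ⟨8, rfl, hrank 8 (by decide), E₄.mul E₄, qExpansion_mul_coeff_zero_eq_one h4 h4,
      funext fun z ↦ congrArg (discriminant z * ·) (sq (E₄ z))⟩
  · exact ⟨10, rfl, hrank 10 (by decide), E₄.mul E₆, qExpansion_mul_coeff_zero_eq_one h4 h6,
      funext fun z ↦ mul_assoc (discriminant z) (E₄ z) (E₆ z)⟩
  · exact ⟨14, rfl, hrank 14 (by decide), (E₄.mul E₄).mul E₆, qExpansion_mul_coeff_zero_eq_one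
      (qExpansion_mul_coeff_zero_eq_one h4 h4) h6, funext fun z ↦ by
        change discriminant z * E₄ z ^ 2 * E₆ z = discriminant z * (E₄ z * E₄ z * E₆ z)
        ring⟩

theorem tau_six_eq {n : ℕ} (hn : 1 ≤ n) : (33108590592 : ℂ) * tau 6 n =
    13759200 * (ArithmeticFunction.sigma 11 n : ℂ) - 691 * (recurrenceSum 6 n : ℚ) := by
  have h6 : 6 ∈ ({6, 8, 9, 10, 11, 13} : Set ℕ) := by simp
  obtain ⟨j, hj, hrank, f, hf, hcusp⟩ := exists_modularForm_cuspDelta_eq h6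
  obtain ⟨F, hF, hone, hspan⟩ := exists_cuspForm_eq_cuspDelta hj hrank f hf hcusp
  have h := recurrenceSum_eq_of_cuspForm (by lia) hF hone hspan (show n ≠ 0 by lia)
  rw [recurrenceSum_one, recurrenceSum_zero, beta_eq h6, g_zero_zero_eq_choose h6,
    bernoulli_even_values.1] at h
  norm_num [beta, Nat.choose] at h
  linear_combination 691 * h

theorem exists_int_factorial_mul_recurrenceSum_six (n : ℕ) :
    ∃ z : ℤ, (Nat.factorial 12 : ℚ) * recurrenceSum 6 n = z := by
  -- `(10)_5 / 2^5 = 30240 / 32 = 945`.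
  have hg : gFactor 6 = (11 * 945 ^ 2 : ℤ) := by
    norm_num [gFactor, fallingFactorial, Finset.prod_range_succ]
  have h : ∀ k : ℤ, ∃ z : ℤ, (Nat.factorial 12 : ℚ) * g 6 n k = z := fun k ↦ by
    rw [g_eq_gFactor_mul, hg, mul_left_comm, mul_div_cancel₀ _ (by positivity), ← Int.cast_mul]
    exact ⟨_, rfl⟩
  choose z hz using h
  refine ⟨∑ k ∈ Finset.Icc (-(n : ℤ)) n, (Int.negOnePow k : ℤ) * z k * p (n - omega k), ?_⟩
  rw [recurrenceSum_eq, Finset.mul_sum, Int.cast_sum]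
  refine Finset.sum_congr rfl fun k _ ↦ ?_
  push_cast
  rw [← hz, Int.cast_negOnePow]
  ring

theorem twelve_dvd_sigma (n : ℕ) : (12 : ℤ) ∣
    5 * (ArithmeticFunction.sigma 3 n : ℤ) + 7 * (ArithmeticFunction.sigma 5 n : ℤ) := by
  rw [ArithmeticFunction.sigma_apply, ArithmeticFunction.sigma_apply]
  push_cast
  rw [Finset.mul_sum, Finset.mul_sum, ← Finset.sum_add_distrib]
  -- Each `5d³ + 7d⁵` is divisible by 12, checked on residues.
  refine Finset.dvd_sum fun d _ ↦ (ZMod.intCast_zmod_eq_zero_iff_dvd _ 12).1 ?_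
  push_cast
  generalize (d : ZMod 12) = x
  revert x
  decide

theorem qExpansion_E_eq_map {k : ℕ} (hk : 3 ≤ k) (he : Even k) {c : ℤ}
    (hc : -(2 * k / bernoulli k) = c) : qExpansion 1 (ModularForm.E hk) = map (Int.castRingHom ℂ)
      (1 + C c * mk fun n ↦ (ArithmeticFunction.sigma (k - 1) n : ℤ)) := by
  have hc : (-(2 * k / bernoulli k) : ℂ) = c := by exact_mod_cast congrArg (Rat.cast : ℚ → ℂ) hc
  ext m
  rw [EisensteinSeries.E_qExpansion_coeff hk he, hc, coeff_map, map_add, coeff_C_mul, coeff_mk,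
    coeff_one]
  split_ifs with h
  · simp [h]
  · simp

theorem qExpansion_discriminant :
    1728 * qExpansion 1 discriminant = qExpansion 1 E₄ ^ 3 - qExpansion 1 E₆ ^ 2 := by
  rw [← ModularForm.qExpansion_pow one_pos one_mem_strictPeriods_SL,
    ← ModularForm.qExpansion_pow one_pos one_mem_strictPeriods_SL,
    ← ModularForm.qExpansion_sub one_pos one_mem_strictPeriods_SL]
  have h : (⇑(E₄.pow 3) - ⇑(E₆.pow 2) : ℍ → ℂ) = (1728 : ℂ) • ⇑CuspForm.discriminant := by
    ext z
    have := discriminant_eq_E₄_cube_sub_E₆_sq z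
    simp only [Pi.sub_apply, ModularForm.coe_pow, Pi.pow_apply, Pi.smul_apply, smul_eq_mul,
      CuspForm.coe_discriminant]
    rw [this]
    ring
  rw [h, ModularForm.qExpansion_smul one_pos one_mem_strictPeriods_SL, smul_eq_C_mul, map_ofNat]
  rfl

theorem exists_int_tau_six_eq (n : ℕ) : ∃ t : ℤ, tau 6 n = t := by
  choose w hw using twelve_dvd_sigma
  set A : ℤ⟦X⟧ := mk fun n ↦ (ArithmeticFunction.sigma 3 n : ℤ)
  set B : ℤ⟦X⟧ := mk fun n ↦ (ArithmeticFunction.sigma 5 n : ℤ)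
  have hE₄ : qExpansion 1 E₄ = map (Int.castRingHom ℂ) (1 + C 240 * A) :=
    qExpansion_E_eq_map (by lia) ⟨2, rfl⟩ (by norm_num [bernoulli, bernoulli'_four])
  have hE₆ : qExpansion 1 E₆ = map (Int.castRingHom ℂ) (1 + C (-504) * B) :=
    qExpansion_E_eq_map (by lia) ⟨3, rfl⟩ (by
      rw [show bernoulli 6 = 1 / 42 by decide +kernel]
      norm_num)
  have hAB : 5 * A + 7 * B = 12 * mk w := by
    ext m
    simp only [← map_ofNat (C : ℤ →+* ℤ⟦X⟧), map_add, coeff_C_mul]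
    simpa [A, B] using hw m
  -- In `(1 + 240A)³ - (1 - 504B)²` the linear part is `144(5A + 7B) = 1728 w`. The other
  -- coefficients are `3·240²/1728 = 100`, `240³/1728 = 8000` and `504²/1728 = 147`.
  have h : qExpansion 1 discriminant =
      map (Int.castRingHom ℂ) (mk w + 100 * A ^ 2 + 8000 * A ^ 3 - 147 * B ^ 2) := by
    have h1 := qExpansion_discriminant
    rw [hE₄, hE₆] at h1
    have h2 := congrArg (map (Int.castRingHom ℂ)) hAB
    have h3 : (1728 : ℂ⟦X⟧) ≠ 0 := by
      rw [← map_ofNat (C : ℂ →+* ℂ⟦X⟧)]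
      simp
    refine mul_left_cancel₀ h3 (h1.trans ?_)
    simp only [map_add, map_sub, map_mul, map_pow, map_ofNat, map_neg, map_one] at h2 ⊢
    linear_combination 144 * h2
  refine ⟨coeff n (mk w + 100 * A ^ 2 + 8000 * A ^ 3 - 147 * B ^ 2), ?_⟩
  change coeff n (qExpansion 1 discriminant) = _
  rw [h, coeff_map]
  rfl

theorem exists_int_tau_six_modEq {n : ℕ} (hn : 1 ≤ n) : ∃ t : ℤ, tau 6 n = t ∧
    t ≡ (ArithmeticFunction.sigma 11 n : ℤ) [ZMOD 691] := by
  obtain ⟨t, ht⟩ := exists_int_tau_six_eq n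
  obtain ⟨z, hz⟩ := exists_int_factorial_mul_recurrenceSum_six n
  refine ⟨t, ht, Int.modEq_iff_dvd.2 ?_⟩
  have h := tau_six_eq hn
  rw [ht] at h
  have h : (33108590592 : ℚ) * t = 13759200 * (ArithmeticFunction.sigma 11 n : ℚ) -
      691 * recurrenceSum 6 n := by exact_mod_cast h
  set s := (ArithmeticFunction.sigma 11 n)
  have h' : (691 * z : ℚ) = Nat.factorial 12 * (13759200 * s - 33108590592 * t) := by
    rw [← hz]
    linear_combination (Nat.factorial 12 : ℚ) * h
  have h' : 691 * z = Nat.factorial 12 * (13759200 * (s : ℤ) - 33108590592 * t) := by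
    exact_mod_cast h'
  -- The factor 12! clears the denominators of the sum over `k` and, like 13759200, is prime to 691.
  have hcop : IsCoprime (691 : ℤ) (Nat.factorial 12 * 13759200) := by
    rw [Int.isCoprime_iff_gcd_eq_one]
    norm_num [Nat.factorial]
  -- The witness uses `33108590592 - 13759200 = 691 · 47894112`.
  refine hcop.dvd_of_dvd_mul_left ⟨z + Nat.factorial 12 * 47894112 * t, ?_⟩
  linear_combination -h'

end RamanujanTau

open PartitionRecurrence in
theorem corollary1p3 :
    -- the space of cusp forms of weight `2ν` is spanned by the normalized form `Δ_{2ν}`,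
    -- and the recurrence for `p(n)` holds
    (∀ ν ∈ ({6, 8, 9, 10, 11, 13} : Set ℕ),
      (∃ f : CuspForm 𝒮ℒ (2 * (ν : ℤ)),
        (f : UpperHalfPlane → ℂ) = cuspDelta ν ∧ tau ν 1 = 1 ∧
          ∀ h : CuspForm 𝒮ℒ (2 * (ν : ℤ)), ∃ c : ℂ, h = c • f) ∧
      ∀ n : ℕ, 1 ≤ n →
        g ν n 0 ≠ 0 ∧
        (p n : ℂ) = 1 / (g ν n 0 : ℂ) *
          (-(4 * (ν : ℂ)) / (bernoulli (2 * ν) : ℂ) * ((2 * ν - 2).choose (ν - 2) : ℂ)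
              * (ArithmeticFunction.sigma (2 * ν - 1) n : ℂ)
            + (beta ν : ℂ) * tau ν n + (pentagonalSum ν n : ℂ))) ∧
    -- the resulting formula for Ramanujan's tau function
    (∀ n : ℕ, 1 ≤ n →
      tau 6 n = 2275 / 5474304 * (ArithmeticFunction.sigma 11 n : ℂ)
        - 691 / 33108590592 * (g 6 n 0 : ℂ) * (p n : ℂ)
        + 691 / 33108590592 * (pentagonalSum 6 n : ℂ)) ∧
    -- the values of Ramanujan's tau function are integers and satisfy the congruence mod 691
    (∀ n : ℕ, 1 ≤ n → ∃ t : ℤ, tau 6 n = (t : ℂ) ∧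
      t ≡ (ArithmeticFunction.sigma 11 n : ℤ) [ZMOD 691]) := by
  refine ⟨fun ν hν ↦ ?_, fun n hn ↦ ?_, fun n hn ↦ exists_int_tau_six_modEq hn⟩
  · obtain ⟨j, hj, hrank, f, hf, hcusp⟩ := exists_modularForm_cuspDelta_eq hν
    exact exists_cuspForm_and_recurrence hj hrank f hf hcusp (g_zero_zero_eq_choose hν) (beta_eq hν)
  · have h := tau_six_eq hn
    rw [recurrenceSum] at h
    push_cast at h
    linear_combination (1 / 33108590592 : ℂ) * h
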